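/- All matrices are complex. For an $n\times n$ matrix $M$ write $H_1=\tfrac12(M+M^*)$ and $H_2=\tfrac1{2i}(M-M^*)$, let $F_M(x,y,t)=\det(xH_1+yH_2+tI_n)$ be its base polynomial (a polynomial in the variables $x,y,t$), and let $W(M)=\{\langle Mx,x\rangle : x\in\mathbb C^n,\ \|x\|=1\}$ be its numerical range. The Gau–Wu number $k(M)$ is the maximum size of an orthonormal set $\{x_1,\dots,x_k\}\subset\mathbb C^n$ such that every value $\langle Mx_j,x_j\rangle$ lies on the boundary $\partial W(M)$. The matrix $M$ is called unitarily reducible if it is unitarily similar to a direct sum of two square matrices of positive size, and unitarily irreducible otherwise. **Proposition 5.1.** Let $n\ge 3$ and let $a,b,c\in\mathbb C$ with $|b|\ne|c|$. Let $A=T_n(a,b,c)$ be the $n\times n$ tridiagonal Toeplitz matrix with $a$ in every diagonal entry, $b$ in every entry of the first superdiagonal and $c$ in every entry of the first subdiagonal. Let $A'$ be the matrix obtained from $A$ by swapping the $(j,j+1)$ entry with the $(j+1,j)$ entry for every odd $j$ with $1\le j\le n-1$. Then $A$ is unitarily irreducible, $A'$ is unitarily reducible, $F_A=F_{A'}$,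 $W(A)=W(A')$, $k(A)=\lceil n/2\rceil$ and $k(A')=2$. In particular, if $n\ge5$, then $k(A)\ne k(A')$. -/

import Mathlib

open scoped Matrix

noncomputable section

namespace GauWu

/-- The `n × n` tridiagonal Toeplitz matrix `T_n(a, b, c)`: `a` on the diagonal, `b` on the first
superdiagonal, `c` on the first subdiagonal and `0` elsewhere. -/
def tridiagToeplitz (n : ℕ) (a b c : ℂ) : Matrix (Fin n) (Fin n) ℂ :=
  Matrix.of fun i j =>
    if i = j then a
    else if (i : ℕ) + 1 = j then b
    else if (j : ℕ) + 1 = i then c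
    else 0

/-- The matrix obtained from `M` by swapping the entries in the positions `(j, j+1)` and
`(j+1, j)` for every odd `j`, where rows and columns are numbered from `1`. As `Fin n` is numbered
from `0`, the row with the odd number `j` is the one with the even index `j - 1`. -/
def swapOdd {n : ℕ} (M : Matrix (Fin n) (Fin n) ℂ) : Matrix (Fin n) (Fin n) ℂ :=
  Matrix.of fun i j =>
    if (Even (i : ℕ) ∧ (i : ℕ) + 1 = j) ∨ (Even (j : ℕ) ∧ (j : ℕ) + 1 = i) then M j i else M i j

/-- `A` is unitarily reducible: it is unitarily similar to a direct sum of two square matrices of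
positive sizes. (The bijection `e` only says in which order the basis vectors are numbered.) -/
def IsUnitarilyReducible {n : ℕ} (A : Matrix (Fin n) (Fin n) ℂ) : Prop :=
  ∃ (p q : ℕ) (_ : 0 < p) (_ : 0 < q) (e : Fin p ⊕ Fin q ≃ Fin n)
    (U : Matrix (Fin n) (Fin n) ℂ) (B : Matrix (Fin p) (Fin p) ℂ) (C : Matrix (Fin q) (Fin q) ℂ),
    U ∈ Matrix.unitaryGroup (Fin n) ℂ ∧
      Uᴴ * A * U = Matrix.reindex e e (Matrix.fromBlocks B 0 0 C)

/-- `A` is unitarily irreducible: it is not unitarily reducible. -/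
def IsUnitarilyIrreducible {n : ℕ} (A : Matrix (Fin n) (Fin n) ℂ) : Prop :=
  ¬ IsUnitarilyReducible A

/-- The Hermitian matrix `Re A = (A + A*) / 2`. -/
def rePart {n : ℕ} (A : Matrix (Fin n) (Fin n) ℂ) : Matrix (Fin n) (Fin n) ℂ :=
  (1 / 2 : ℂ) • (A + Aᴴ)

/-- The Hermitian matrix `Im A = (A - A*) / (2i)`. -/
def imPart {n : ℕ} (A : Matrix (Fin n) (Fin n) ℂ) : Matrix (Fin n) (Fin n) ℂ :=
  (1 / (2 * Complex.I) : ℂ) • (A - Aᴴ)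

/-- The base polynomial `F_A(x, y, t) = det (x Re A + y Im A + t I)`, as a polynomial in the three
variables `x = X 0`, `y = X 1`, `t = X 2`. -/
def basePolynomial {n : ℕ} (A : Matrix (Fin n) (Fin n) ℂ) : MvPolynomial (Fin 3) ℂ :=
  Matrix.det
    ((MvPolynomial.X 0 : MvPolynomial (Fin 3) ℂ) • (rePart A).map MvPolynomial.C
      + (MvPolynomial.X 1 : MvPolynomial (Fin 3) ℂ) • (imPart A).map MvPolynomial.C
      + (MvPolynomial.X 2 : MvPolynomial (Fin 3) ℂ) •
          (1 : Matrix (Fin n) (Fin n) (MvPolynomial (Fin 3) ℂ)))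

/-- The scalar product `⟨A x, x⟩`, linear in the entry `A x`. (Mathlib's inner product is linear in
its second entry.) -/
def quadForm {n : ℕ} (A : Matrix (Fin n) (Fin n) ℂ) (x : EuclideanSpace ℂ (Fin n)) : ℂ :=
  inner ℂ x (Matrix.toEuclideanLin A x)

/-- The numerical range `W(A) = {⟨A x, x⟩ : ‖x‖ = 1}`. -/
def numericalRange {n : ℕ} (A : Matrix (Fin n) (Fin n) ℂ) : Set ℂ :=
  {z | ∃ x : EuclideanSpace ℂ (Fin n), ‖x‖ = 1 ∧ quadForm A x = z}

/-- The sizes `m` of the orthonormal families `x_1, …, x_m` in `ℂⁿ` for which every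
`⟨A x_j, x_j⟩` lies on the boundary of `W(A)`. -/
def boundaryOrthonormalSizes {n : ℕ} (A : Matrix (Fin n) (Fin n) ℂ) : Set ℕ :=
  {m | ∃ x : Fin m → EuclideanSpace ℂ (Fin n), Orthonormal ℂ x ∧
    ∀ j, quadForm A (x j) ∈ frontier (numericalRange A)}

/-- The Gau–Wu number `k(A)`: the greatest size of an orthonormal family `x_1, …, x_m` for which
every `⟨A x_j, x_j⟩` lies on the boundary of `W(A)`. -/
def gauWuNumber {n : ℕ} (A : Matrix (Fin n) (Fin n) ℂ) : ℕ :=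
  sSup (boundaryOrthonormalSizes A)

/-- The supremum that defines the Gau–Wu number is a maximum. -/
theorem isGreatest_gauWuNumber {n : ℕ} (A : Matrix (Fin n) (Fin n) ℂ) :
    IsGreatest (boundaryOrthonormalSizes A) (gauWuNumber A) := by
  have hb : BddAbove (boundaryOrthonormalSizes A) := by
    refine ⟨n, ?_⟩
    rintro m ⟨x, hx, -⟩
    simpa using hx.linearIndependent.fintype_card_le_finrank
  have hne : (boundaryOrthonormalSizes A).Nonempty :=
    ⟨0, fun j => j.elim0, ⟨fun j => j.elim0, fun j => j.elim0⟩, fun j => j.elim0⟩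
  exact ⟨Nat.sSup_mem hne hb, fun m hm => le_csSup hb hm⟩

end GauWu

end

/-! Write `n = m + 1`, `N = m + 2` and `q = pathRoot m = exp(2πi/N)`. Both matrices have the form `a
I + b S + c S*`, where `S` is the 0-1 matrix of the upward steps of a zigzag `κ` along a path: `κ =
id` gives `A`, and `κ = alternation` gives `A'`. For unit `x` the form is `a + b z + c z̄` with `z =
⟨Sx, x⟩`, and this real-affine map is a homeomorphism since `|b| ≠ |c|`. So only `S` matters for the
boundary.

A sum of squares built on the Perron vector `sin(jπ/N)` of the path shows that `W(S)` is the disc of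
radius `cos(π/N)` for every zigzag, and that the unit vectors reaching its boundary are the
multiples of `ω ^ κ j * sin((j+1)π/N)` with `|ω| = 1`. Orthogonality of two of them depends only on
the ratio `z` of their phases: `∑ sin²((j+1)π/N) z ^ κ j = 0`.

For `alternation` this says `z = -1`, so at most two phases are compatible. For `id` the zeros are
the `N`-th roots of unity other than `1, q, q⁻¹`, together with `-1` (`pathPoly_factored`). The even
powers of `q` then give `⌊N/2⌋ = ⌈n/2⌉` phases, and `card_le_of_pathPoly_eq_zero` shows that this is
optimal.

Irreducibility of `A` holds because only scalars commute with the shift and its adjoint;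
reducibility of `A'` because `S² = 0`, so `SS* + S*S` commutes with `A'`. The base polynomials agree
by a diagonal similarity of the pencils. -/

noncomputable section

namespace GauWu

open scoped ComplexConjugate

/-! ### The Perron vector of the path -/

/-- The sines whose values at `1, …, m + 1` are the entries of the Perron vector of the path with
`m + 1` vertices. -/
def pathSin (m j : ℕ) : ℝ := Real.sin (j * (Real.pi / (m + 2)))

/-- Half the spectral radius of the path with `m + 1` vertices. -/
def pathRadius (m : ℕ) : ℝ := Real.cos (Real.pi / (m + 2))

lemma pathSin_zero (m : ℕ) : pathSin m 0 = 0 := by simp [pathSin]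

lemma pathSin_last (m : ℕ) : pathSin m (m + 2) = 0 := by
  have h : ((m : ℝ) + 2) ≠ 0 := by positivity
  simp only [pathSin]
  push_cast
  rw [mul_div_cancel₀ _ h, Real.sin_pi]

lemma pathSin_pos {m j : ℕ} (h0 : 0 < j) (hj : j < m + 2) : 0 < pathSin m j := by
  have h : (0 : ℝ) < (m : ℝ) + 2 := by positivity
  have hj' : (j : ℝ) < (m : ℝ) + 2 := by exact_mod_cast hj
  have h0' : (0 : ℝ) < j := by exact_mod_cast h0
  apply Real.sin_pos_of_pos_of_lt_pi
  · have := Real.pi_pos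
    positivity
  · rw [mul_div_assoc', div_lt_iff₀ h, mul_comm]
    exact mul_lt_mul_of_pos_left hj' Real.pi_pos

lemma pathSin_recurrence (m j : ℕ) :
    pathSin m j + pathSin m (j + 2) = 2 * pathRadius m * pathSin m (j + 1) := by
  simp only [pathSin, pathRadius]
  push_cast
  set t := Real.pi / ((m : ℝ) + 2)
  have h1 : (j : ℝ) * t = (j + 1) * t - t := by ring
  have h2 : ((j : ℝ) + 2) * t = (j + 1) * t + t := by ring
  rw [h1, h2, Real.sin_sub, Real.sin_add]
  ring

lemma pathRadius_pos {m : ℕ} (hm : 0 < m) : 0 < pathRadius m := by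
  have hm' : (0 : ℝ) < m := by exact_mod_cast hm
  apply Real.cos_pos_of_mem_Ioo
  have := Real.pi_pos
  constructor
  · have : 0 < Real.pi / ((m : ℝ) + 2) := by positivity
    linarith
  · apply div_lt_div_of_pos_left Real.pi_pos <;> linarith

/-- Regrouping the edge terms by vertex, the recurrence gives each vertex the total weight `2 *
pathRadius m`. The end vertices fit because the sines vanish at `0` and `m + 2`. -/
lemma sum_path_weights (m : ℕ) (u : Fin (m + 1) → ℝ) :
    ∑ k : Fin m, (pathSin m (k + 1) / pathSin m (k + 2) * u k.succ
      + pathSin m (k + 2) / pathSin m (k + 1) * u k.castSucc)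
      = 2 * pathRadius m * ∑ j, u j := by
  have h : ∀ j : Fin (m + 1), 2 * pathRadius m * u j
      = pathSin m j / pathSin m (j + 1) * u j + pathSin m (j + 2) / pathSin m (j + 1) * u j := by
    intro j
    have hp : 0 < pathSin m (j + 1) := pathSin_pos (by omega) (by omega)
    field_simp
    rw [mul_comm (u j), mul_right_comm, ← pathSin_recurrence]
  rw [Finset.mul_sum, Finset.sum_congr rfl fun j _ => h j, Finset.sum_add_distrib,
    Finset.sum_add_distrib]
  congr 1
  · rw [Fin.sum_univ_succ]
    simp [pathSin_zero, add_assoc]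
  · rw [Fin.sum_univ_castSucc]
    simp [pathSin_last]

lemma normSq_sub_scaled {p q : ℝ} (hp : p ≠ 0) (hq : q ≠ 0) (x y ω : ℂ) (hω : ‖ω‖ = 1) :
    p * q * Complex.normSq (y / q - ω * (x / p))
      = p / q * Complex.normSq y + q / p * Complex.normSq x - 2 * (conj y * (ω * x)).re := by
  have h1 : Complex.normSq ω = 1 := by rw [Complex.normSq_eq_norm_sq, hω, one_pow]
  have e1 : Complex.normSq (y / q - ω * (x / p)) = Complex.normSq y / q ^ 2
      + Complex.normSq x / p ^ 2 - 2 * (conj y * (ω * x)).re / (p * q) := by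
    rw [Complex.normSq_sub]
    simp only [map_mul, map_div₀, Complex.normSq_ofReal, h1, Complex.conj_ofReal]
    have : y / (q : ℂ) * (conj ω * (conj x / (p : ℂ)))
      = ((1 / (p * q) : ℝ) : ℂ) * (y * conj (ω * x)) := by
      push_cast
      rw [map_mul]
      field_simp
    rw [this, Complex.re_ofReal_mul]
    have : (y * conj (ω * x)).re = (conj y * (ω * x)).re := by
      rw [← Complex.conj_re, map_mul, Complex.conj_conj]
    rw [this]
    field_simp
  rw [e1]
  field_simp

/-- The sum-of-squares identity behind the bound on the numerical radius of a path. -/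
lemma path_sum_of_squares (m : ℕ) (x : Fin (m + 1) → ℂ) (ω : Fin m → ℂ) (hω : ∀ k, ‖ω k‖ = 1) :
    ∑ k : Fin m, pathSin m (k + 1) * pathSin m (k + 2) *
      Complex.normSq (x k.succ / pathSin m (k + 2) - ω k * (x k.castSucc / pathSin m (k + 1)))
      = 2 * pathRadius m * ∑ j, Complex.normSq (x j)
        - 2 * ∑ k : Fin m, (conj (x k.succ) * (ω k * x k.castSucc)).re := by
  rw [← sum_path_weights, Finset.mul_sum, ← Finset.sum_sub_distrib]
  refine Finset.sum_congr rfl fun k _ => ?_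
  exact normSq_sub_scaled (pathSin_pos (by omega) (by omega)).ne'
    (pathSin_pos (by omega) (by omega)).ne' _ _ _ (hω k)

/-! ### The weighted power sums of the squared Perron vector -/

/-- `∑ⱼ sin²(jπ/(m+2)) zʲ`. -/
def pathPoly (m : ℕ) (z : ℂ) : ℂ :=
  ∑ j ∈ Finset.range (m + 2), ((pathSin m j ^ 2 : ℝ) : ℂ) * z ^ j

/-- The primitive root of unity `exp(2πi/(m+2))`. -/
def pathRoot (m : ℕ) : ℂ := Complex.exp (2 * Real.pi * Complex.I / ((m + 2 : ℕ) : ℂ))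

lemma pathRoot_isPrimitive (m : ℕ) : IsPrimitiveRoot (pathRoot m) (m + 2) :=
  Complex.isPrimitiveRoot_exp (m + 2) (by omega)

lemma four_mul_pathSin_sq (m j : ℕ) :
    4 * ((pathSin m j ^ 2 : ℝ) : ℂ) = 2 - pathRoot m ^ j - (pathRoot m)⁻¹ ^ j := by
  have h : ((m : ℂ) + 2) ≠ 0 := by exact_mod_cast (by omega : m + 2 ≠ 0)
  have e1 : pathRoot m ^ j = Complex.exp (2 * (j * (Real.pi / (m + 2))) * Complex.I) := by
    rw [pathRoot, ← Complex.exp_nat_mul]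
    congr 1
    push_cast
    ring
  have e2 : (pathRoot m)⁻¹ ^ j = Complex.exp (-(2 * (j * (Real.pi / (m + 2)))) * Complex.I) := by
    rw [inv_pow, e1, ← Complex.exp_neg, neg_mul]
  have e3 := Complex.two_cos (2 * (j * (Real.pi / (m + 2))))
  rw [e1, e2, sub_sub, ← e3, Complex.cos_two_mul, pathSin]
  push_cast
  have := Complex.sin_sq_add_cos_sq ((j : ℂ) * (Real.pi / (m + 2)))
  linear_combination 4 * this

lemma four_mul_pathPoly (m : ℕ) (z : ℂ) :
    4 * pathPoly m z = 2 * ∑ j ∈ Finset.range (m + 2), z ^ j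
      - ∑ j ∈ Finset.range (m + 2), (z * pathRoot m) ^ j
      - ∑ j ∈ Finset.range (m + 2), (z * (pathRoot m)⁻¹) ^ j := by
  simp only [pathPoly, Finset.mul_sum, ← Finset.sum_sub_distrib]
  refine Finset.sum_congr rfl fun j _ => ?_
  rw [← mul_assoc, four_mul_pathSin_sq, mul_pow, mul_pow]
  ring

/-- As `q ^ (m + 2) = 1`, the three geometric sums share the numerator `z ^ (m + 2) - 1` and combine
over a common denominator. This locates all zeros except at `1`, `q` and `q⁻¹`. -/
lemma pathPoly_factored (m : ℕ) (z : ℂ) :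
    4 * pathPoly m z * ((z - 1) * (z * pathRoot m - 1) * (z * (pathRoot m)⁻¹ - 1))
      = (z ^ (m + 2) - 1) * (2 - pathRoot m - (pathRoot m)⁻¹) * (z * (z + 1)) := by
  have hq := (pathRoot_isPrimitive m).pow_eq_one
  have hq0 : pathRoot m ≠ 0 := (pathRoot_isPrimitive m).ne_zero (by omega)
  have g1 := geom_sum_mul z (m + 2)
  have g2 := geom_sum_mul (z * pathRoot m) (m + 2)
  have g3 := geom_sum_mul (z * (pathRoot m)⁻¹) (m + 2)
  rw [mul_pow, hq, mul_one] at g2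
  rw [mul_pow, inv_pow, hq, inv_one, mul_one] at g3
  have hi : pathRoot m * (pathRoot m)⁻¹ = 1 := mul_inv_cancel₀ hq0
  rw [four_mul_pathPoly]
  set q := pathRoot m
  set p := q⁻¹
  linear_combination 2 * (z * q - 1) * (z * p - 1) * g1 - (z - 1) * (z * p - 1) * g2
    - (z - 1) * (z * q - 1) * g3 + 2 * (z ^ (m + 2) - 1) * z ^ 2 * hi

lemma pathRoot_ne_one (m : ℕ) : pathRoot m ≠ 1 :=
  (pathRoot_isPrimitive m).ne_one (by omega)

lemma eq_neg_one_or_pow_eq_one_of_pathPoly_eq_zero {m : ℕ} {z : ℂ} (hz : z ≠ 0)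
    (h : pathPoly m z = 0) : z ^ (m + 2) = 1 ∨ z = -1 := by
  have hf := pathPoly_factored m z
  have hq0 : pathRoot m ≠ 0 := (pathRoot_isPrimitive m).ne_zero (by omega)
  have hs : 2 - pathRoot m - (pathRoot m)⁻¹ ≠ 0 := by
    intro hs
    apply pathRoot_ne_one m
    -- The constant equals `-(q - 1)² / q`.
    have : (pathRoot m - 1) ^ 2 = 0 := by
      field_simp at hs
      linear_combination -hs
    exact sub_eq_zero.mp (pow_eq_zero_iff (two_ne_zero) |>.mp this)
  rw [h, mul_zero, zero_mul, eq_comm, mul_eq_zero, mul_eq_zero, mul_eq_zero] at hf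
  rcases hf with (hf | hf) | (hf | hf)
  · exact Or.inl (sub_eq_zero.mp hf)
  · exact absurd hf hs
  · exact absurd hf hz
  · exact Or.inr (eq_neg_of_add_eq_zero_left hf)

lemma pathPoly_eq_zero {m : ℕ} {z : ℂ} (h1 : z ≠ 1) (h2 : z ≠ pathRoot m)
    (h3 : z * pathRoot m ≠ 1) (h : z ^ (m + 2) = 1 ∨ z = -1) : pathPoly m z = 0 := by
  have hf := pathPoly_factored m z
  have hq0 : pathRoot m ≠ 0 := (pathRoot_isPrimitive m).ne_zero (by omega)
  have h0 : (z ^ (m + 2) - 1) * (2 - pathRoot m - (pathRoot m)⁻¹) * (z * (z + 1)) = 0 := by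
    rcases h with h | h <;> simp [h]
  rw [h0, mul_eq_zero, mul_eq_zero, mul_eq_zero] at hf
  have h4 : z * (pathRoot m)⁻¹ - 1 ≠ 0 := by
    rw [sub_ne_zero]
    intro h
    exact h2 (by field_simp at h; exact h)
  simpa [sub_ne_zero.mpr h1, sub_ne_zero.mpr h3, h4] using hf

lemma sum_pow_eq_zero {N : ℕ} {z : ℂ} (h : z ^ N = 1) (h1 : z ≠ 1) :
    ∑ j ∈ Finset.range N, z ^ j = 0 := by
  have := geom_sum_mul z N
  rw [h, sub_self, mul_eq_zero] at this
  exact this.resolve_right (sub_ne_zero.mpr h1)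

lemma pathRoot_sq_ne_one {m : ℕ} (hm : 0 < m) : pathRoot m ^ 2 ≠ 1 :=
  (pathRoot_isPrimitive m).pow_ne_one_of_pos_of_lt (by omega) (by omega)

/-- At `z = q` two of the geometric sums vanish and the third has all terms `1`, so four times the
value is `-(m + 2)`. Hence orthogonal extremal vectors never have phase ratio `q`. -/
lemma pathPoly_pathRoot_ne_zero {m : ℕ} (hm : 0 < m) : pathPoly m (pathRoot m) ≠ 0 := by
  have hq := (pathRoot_isPrimitive m).pow_eq_one
  have hq0 : pathRoot m ≠ 0 := (pathRoot_isPrimitive m).ne_zero (by omega)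
  have h := four_mul_pathPoly m (pathRoot m)
  rw [sum_pow_eq_zero hq (pathRoot_ne_one m), sum_pow_eq_zero (by rw [mul_pow, hq, mul_one])
    (by rw [← sq]; exact pathRoot_sq_ne_one hm), mul_inv_cancel₀ hq0] at h
  intro h0
  rw [h0] at h
  have : ((m : ℂ) + 2) = 0 := by
    simp only [one_pow, Finset.sum_const, Finset.card_range, nsmul_eq_mul] at h
    push_cast at h
    linear_combination h
  exact absurd this (by exact_mod_cast (by omega : m + 2 ≠ 0))

lemma pathPoly_neg_one {m : ℕ} (hm : 0 < m) : pathPoly m (-1) = 0 := by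
  have hsq := pathRoot_sq_ne_one hm
  refine pathPoly_eq_zero (by norm_num) (fun h => hsq (by rw [← h]; norm_num))
    (fun h => hsq ?_) (Or.inr rfl)
  have : pathRoot m = -1 := by linear_combination -h
  rw [this]; norm_num

lemma sum_pathSin_sq_mul_pow (m : ℕ) (z : ℂ) :
    z * ∑ j : Fin (m + 1), ((pathSin m (j + 1) ^ 2 : ℝ) : ℂ) * z ^ (j : ℕ) = pathPoly m z := by
  rw [pathPoly, Finset.sum_range_succ', pathSin_zero, Finset.mul_sum,
    ← Fin.sum_univ_eq_sum_range (fun j => ((pathSin m (j + 1) ^ 2 : ℝ) : ℂ) * z ^ (j + 1))]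
  simp only [ne_eq, OfNat.ofNat_ne_zero, not_false_eq_true, zero_pow, Complex.ofReal_zero,
    zero_mul, add_zero]
  refine Finset.sum_congr rfl fun j _ => ?_
  ring

/-- The squared norm of the vector of sines. -/
def pathNormSq (m : ℕ) : ℝ := ∑ j : Fin (m + 1), pathSin m (j + 1) ^ 2

lemma pathNormSq_pos (m : ℕ) : 0 < pathNormSq m :=
  Finset.sum_pos (fun j _ => pow_pos (pathSin_pos (by omega) (by omega)) 2) ⟨0, Finset.mem_univ _⟩

lemma sum_alternating_pathSin_sq {m : ℕ} (hm : 0 < m) :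
    ∑ j : Fin (m + 1), pathSin m (j + 1) ^ 2 * (-1) ^ (j : ℕ) = 0 := by
  have h := sum_pathSin_sq_mul_pow m (-1)
  rw [pathPoly_neg_one hm, neg_one_mul, neg_eq_zero] at h
  exact_mod_cast h

/-- The zero of `pathPoly` at `-1` means that the squared Perron vector has equal mass on even and
odd positions. -/
lemma sum_parity_weights {m : ℕ} (hm : 0 < m) (p q : ℝ) :
    ∑ j : Fin (m + 1), pathSin m (j + 1) ^ 2 * (if Even (j : ℕ) then p else q)
      = pathNormSq m * ((p + q) / 2) := by
  have h := sum_alternating_pathSin_sq hm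
  have e : ∀ j : Fin (m + 1), pathSin m (j + 1) ^ 2 * (if Even (j : ℕ) then p else q)
      = pathSin m (j + 1) ^ 2 * ((p + q) / 2)
        + pathSin m (j + 1) ^ 2 * (-1) ^ (j : ℕ) * ((p - q) / 2) := by
    intro j
    rcases Nat.even_or_odd (j : ℕ) with hj | hj
    · rw [if_pos hj, hj.neg_one_pow]; ring
    · rw [if_neg (Nat.not_even_iff_odd.mpr hj), hj.neg_one_pow]; ring
  rw [Finset.sum_congr rfl fun j _ => e j, Finset.sum_add_distrib, ← Finset.sum_mul,
    ← Finset.sum_mul, h, zero_mul, add_zero, pathNormSq]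

/-! ### Zigzag Toeplitz matrices -/

/-- A sequence of naturals is a zigzag if consecutive values differ by exactly one. -/
def IsZigzag (κ : ℕ → ℕ) : Prop := ∀ k, κ (k + 1) = κ k + 1 ∨ κ k = κ (k + 1) + 1

/-- The tridiagonal matrix with diagonal `a` whose off-diagonal entries are `b` where the zigzag
`κ` goes up and `c` where it goes down. -/
def zigzagToeplitz (κ : ℕ → ℕ) (n : ℕ) (a b c : ℂ) : Matrix (Fin n) (Fin n) ℂ :=
  Matrix.of fun i j =>
    if i = j then a
    else if (i : ℕ) + 1 = j ∨ (j : ℕ) + 1 = i then (if κ j = κ i + 1 then b else c)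
    else 0

/-- The exponents that alternate between `1` and `0`. -/
def alternation (j : ℕ) : ℕ := if Even j then 1 else 0

lemma isZigzag_id : IsZigzag id := fun _ => Or.inl rfl

lemma isZigzag_alternation : IsZigzag alternation := by
  intro k
  rcases Nat.even_or_odd k with h | h
  · right; simp [alternation, h, Nat.even_add_one]
  · left; simp [alternation, Nat.not_even_iff_odd.mpr h, Nat.even_add_one]

lemma tridiagToeplitz_eq_zigzag (n : ℕ) (a b c : ℂ) :
    tridiagToeplitz n a b c = zigzagToeplitz id n a b c := by
  ext i j
  simp only [tridiagToeplitz, zigzagToeplitz, Matrix.of_apply, id]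
  split_ifs <;> first | rfl | omega

lemma swapOdd_tridiagToeplitz_eq_zigzag (n : ℕ) (a b c : ℂ) :
    swapOdd (tridiagToeplitz n a b c) = zigzagToeplitz alternation n a b c := by
  ext i j
  by_cases hij : i = j
  · subst hij
    simp [swapOdd, tridiagToeplitz, zigzagToeplitz]
  have hji : ¬ j = i := fun h => hij h.symm
  simp only [swapOdd, tridiagToeplitz, zigzagToeplitz, Matrix.of_apply, hij, hji, if_false]
  by_cases h1 : (i : ℕ) + 1 = j
  · have h2 : ¬ (j : ℕ) + 1 = i := by omega
    rw [← h1] at h2 ⊢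
    by_cases h : Even (i : ℕ) <;> simp [h, h2, alternation, Nat.even_add_one]
  · by_cases h2 : (j : ℕ) + 1 = i
    · rw [← h2] at h1 ⊢
      by_cases h : Even (j : ℕ) <;> simp [h, h1, alternation, Nat.even_add_one]
    · simp [h1, h2]

/-- The value of the quadratic form of the `0`-`1` matrix of the upward steps of `κ`. -/
def stepForm {m : ℕ} (κ : ℕ → ℕ) (x : Fin (m + 1) → ℂ) : ℂ :=
  ∑ k : Fin m, if κ (k + 1) = κ k + 1 then conj (x k.castSucc) * x k.succ
    else conj (x k.succ) * x k.castSucc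

lemma conj_mul_self_sub_ne_zero {b c : ℂ} (hbc : ‖b‖ ≠ ‖c‖) : conj b * b - conj c * c ≠ 0 := by
    rw [Complex.conj_mul', Complex.conj_mul', sub_ne_zero]
    intro h
    exact hbc ((pow_left_inj₀ (norm_nonneg _) (norm_nonneg _) two_ne_zero).mp (by exact_mod_cast h))

/-- The affine transformation `z ↦ a + b z + c z̄`, invertible as `|b| ≠ |c|`. -/
def affineConj (a b c : ℂ) (hbc : ‖b‖ ≠ ‖c‖) : ℂ ≃ₜ ℂ where
  toFun z := a + b * z + c * conj z
  invFun w := (conj b * (w - a) - c * conj (w - a)) / (conj b * b - conj c * c)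
  left_inv z := by
    have h := conj_mul_self_sub_ne_zero hbc
    rw [div_eq_iff h]
    simp only [map_add, map_sub, map_mul, Complex.conj_conj]
    ring
  right_inv w := by
    have h := conj_mul_self_sub_ne_zero hbc
    have h' : b * conj b - c * conj c ≠ 0 := by rwa [mul_comm b, mul_comm c]
    simp only [map_sub, map_mul, map_div₀, Complex.conj_conj]
    field_simp
    ring
  continuous_toFun := by fun_prop
  continuous_invFun := by fun_prop

lemma affineConj_apply (a b c : ℂ) (hbc : ‖b‖ ≠ ‖c‖) (z : ℂ) :
    affineConj a b c hbc z = a + b * z + c * conj z := rfl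

lemma sum_superdiagonal {m : ℕ} (f : Fin (m + 1) → Fin (m + 1) → ℂ) :
    ∑ i : Fin (m + 1), ∑ j : Fin (m + 1), (if (i : ℕ) + 1 = j then f i j else 0)
      = ∑ k : Fin m, f k.castSucc k.succ := by
  rw [Fin.sum_univ_castSucc]
  have hl : ∑ j : Fin (m + 1), (if ((Fin.last m : Fin (m + 1)) : ℕ) + 1 = j
      then f (Fin.last m) j else 0) = 0 := by
    refine Finset.sum_eq_zero fun j _ => if_neg ?_
    simp only [Fin.val_last]
    omega
  rw [hl, add_zero]
  refine Finset.sum_congr rfl fun k _ => ?_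
  rw [Finset.sum_eq_single k.succ]
  · simp
  · intro j _ hj
    refine if_neg fun h => hj (Fin.ext ?_)
    simpa using h.symm
  · simp

lemma quadForm_eq_sum {n : ℕ} (A : Matrix (Fin n) (Fin n) ℂ) (x : EuclideanSpace ℂ (Fin n)) :
    quadForm A x = ∑ i, ∑ j, conj (x i) * A i j * x j := by
  rw [quadForm, PiLp.inner_apply]
  refine Finset.sum_congr rfl fun i _ => ?_
  simp only [RCLike.inner_apply, Matrix.toLpLin_apply, Matrix.mulVec, dotProduct,
    Finset.sum_mul]
  refine Finset.sum_congr rfl fun j _ => ?_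
  ring

lemma sum_normSq_eq {n : ℕ} (x : EuclideanSpace ℂ (Fin n)) :
    ∑ j, Complex.normSq (x j) = ‖x‖ ^ 2 := by
  rw [EuclideanSpace.norm_sq_eq]
  simp [Complex.normSq_eq_norm_sq]

lemma quadForm_zigzag {m : ℕ} {κ : ℕ → ℕ} (hκ : IsZigzag κ) (a b c : ℂ) (hbc : ‖b‖ ≠ ‖c‖)
    {x : EuclideanSpace ℂ (Fin (m + 1))} (hx : ‖x‖ = 1) :
    quadForm (zigzagToeplitz κ (m + 1) a b c) x = affineConj a b c hbc (stepForm κ x) := by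
  have hd : ∀ i j : Fin (m + 1), conj (x i : ℂ) * zigzagToeplitz κ (m + 1) a b c i j * x j
      = (if i = j then a * (Complex.normSq (x i) : ℂ) else 0)
        + (if (i : ℕ) + 1 = j then conj (x i) * (if κ j = κ i + 1 then b else c) * x j else 0)
        + (if (j : ℕ) + 1 = i then conj (x i) * (if κ j = κ i + 1 then b else c) * x j else 0) := by
    intro i j
    by_cases hij : i = j
    · subst hij
      simp only [zigzagToeplitz, Matrix.of_apply, if_true, Nat.succ_ne_self, if_false, add_zero]
      rw [Complex.normSq_eq_conj_mul_self]
      ring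
    · simp only [zigzagToeplitz, Matrix.of_apply, hij, if_false, zero_add]
      by_cases h1 : (i : ℕ) + 1 = j
      · have h2 : ¬ (j : ℕ) + 1 = i := by omega
        simp [h1, h2]
      · by_cases h2 : (j : ℕ) + 1 = i <;> simp [h1, h2]
  have hn : ∑ i, (Complex.normSq (x i) : ℂ) = 1 := by
    rw [← Complex.ofReal_sum, sum_normSq_eq, hx]; simp
  rw [quadForm_eq_sum]
  simp only [hd, Finset.sum_add_distrib]
  rw [sum_superdiagonal (fun i j => conj (x i) * (if κ j = κ i + 1 then b else c) * x j),
    Finset.sum_comm (f := fun i j : Fin (m + 1) => if (j : ℕ) + 1 = i then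
      conj (x i) * (if κ j = κ i + 1 then b else c) * x j else 0),
    sum_superdiagonal (fun j i => conj (x i) * (if κ j = κ i + 1 then b else c) * x j)]
  simp only [Finset.sum_ite_eq, Finset.mem_univ, if_true]
  rw [← Finset.mul_sum, hn, mul_one, affineConj_apply, stepForm, map_sum, Finset.mul_sum,
    Finset.mul_sum, add_assoc, add_assoc, ← Finset.sum_add_distrib, ← Finset.sum_add_distrib]
  congr 1
  refine Finset.sum_congr rfl fun k _ => ?_
  simp only [Fin.val_castSucc, Fin.val_succ]
  rcases hκ k with h | h
  · have h' : ¬ κ k = κ (k + 1) + 1 := by omega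
    rw [if_pos h, if_neg h', if_pos h, map_mul, Complex.conj_conj]
    ring
  · have h' : ¬ κ (k + 1) = κ k + 1 := by omega
    rw [if_pos h, if_neg h', if_neg h', map_mul, Complex.conj_conj]
    ring

/-! ### The numerical range as an affine image of a disc, and the extremal vectors -/

/-- The phase of the edge `k` for the vectors that are extremal in the direction `ω`. -/
def stepPhase (κ : ℕ → ℕ) (ω : ℂ) (k : ℕ) : ℂ := if κ (k + 1) = κ k + 1 then ω else conj ω

lemma norm_stepPhase (κ : ℕ → ℕ) {ω : ℂ} (hω : ‖ω‖ = 1) (k : ℕ) : ‖stepPhase κ ω k‖ = 1 := by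
  unfold stepPhase
  split_ifs <;> simp [hω]

lemma conj_mul_self_of_norm_one {ω : ℂ} (hω : ‖ω‖ = 1) : conj ω * ω = 1 := by
  rw [Complex.conj_mul', hω]; simp

/-- The zigzag is a potential for the edge phases: a diagonal unitary with entries `ω ^ κ j` removes
them all. -/
lemma stepPhase_mul_pow {κ : ℕ → ℕ} (hκ : IsZigzag κ) {ω : ℂ} (hω : ‖ω‖ = 1) (k : ℕ) :
    stepPhase κ ω k * ω ^ κ k = ω ^ κ (k + 1) := by
  unfold stepPhase
  rcases hκ k with h | h
  · rw [if_pos h, h, pow_succ']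
  · have h' : ¬ κ (k + 1) = κ k + 1 := by omega
    rw [if_neg h', h, pow_succ', ← mul_assoc, conj_mul_self_of_norm_one hω, one_mul]

lemma sum_re_stepPhase {m : ℕ} (κ : ℕ → ℕ) (x : Fin (m + 1) → ℂ) (ω : ℂ) :
    ∑ k : Fin m, (conj (x k.succ) * (stepPhase κ ω k * x k.castSucc)).re
      = (conj ω * stepForm κ x).re := by
  rw [stepForm, Finset.mul_sum, Complex.re_sum]
  refine Finset.sum_congr rfl fun k _ => ?_
  unfold stepPhase
  split_ifs
  · rw [← Complex.conj_re]
    simp only [map_mul, Complex.conj_conj]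
    congr 1
    ring
  · congr 1
    ring

lemma exists_phase (z : ℂ) : ∃ ω : ℂ, ‖ω‖ = 1 ∧ z = ‖z‖ * ω := by
  refine ⟨Complex.exp (z.arg * Complex.I), Complex.norm_exp_ofReal_mul_I _, ?_⟩
  exact (Complex.norm_mul_exp_arg_mul_I z).symm

lemma re_conj_phase_mul {z ω : ℂ} {t : ℝ} (hω : ‖ω‖ = 1) (hz : z = t * ω) :
    (conj ω * z).re = t := by
  rw [hz, mul_left_comm, conj_mul_self_of_norm_one hω]
  simp

/-- With `ω` the phase of the value, the sum of squares equals twice the difference of the two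
sides. -/
lemma norm_stepForm_le {m : ℕ} (κ : ℕ → ℕ) {x : EuclideanSpace ℂ (Fin (m + 1))} (hx : ‖x‖ = 1) :
    ‖stepForm κ x‖ ≤ pathRadius m := by
  obtain ⟨ω, hω, hz⟩ := exists_phase (stepForm κ x)
  have h := path_sum_of_squares m x (fun k => stepPhase κ ω k) fun k => norm_stepPhase κ hω k
  rw [sum_re_stepPhase, re_conj_phase_mul hω hz, sum_normSq_eq, hx] at h
  have : 0 ≤ ∑ k : Fin m, pathSin m (k + 1) * pathSin m (k + 2) * Complex.normSq
      (x k.succ / pathSin m (k + 2) - stepPhase κ ω k * (x k.castSucc / pathSin m (k + 1))) := by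
    refine Finset.sum_nonneg fun k _ => mul_nonneg (mul_nonneg ?_ ?_) (Complex.normSq_nonneg _)
    · exact (pathSin_pos (by omega) (by omega)).le
    · exact (pathSin_pos (by omega) (by omega)).le
  linarith

/-- Equality makes every square vanish, which determines each entry from its predecessor. -/
lemma exists_phase_of_norm_stepForm_eq {m : ℕ} {κ : ℕ → ℕ} (hκ : IsZigzag κ)
    {x : EuclideanSpace ℂ (Fin (m + 1))} (hx : ‖x‖ = 1) (h : ‖stepForm κ x‖ = pathRadius m) :
    ∃ α ω : ℂ, α ≠ 0 ∧ ‖ω‖ = 1 ∧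
      ∀ j : Fin (m + 1), x j = α * (ω ^ κ j * pathSin m (j + 1)) := by
  obtain ⟨ω, hω, hz⟩ := exists_phase (stepForm κ x)
  have hs := path_sum_of_squares m x (fun k => stepPhase κ ω k) fun k => norm_stepPhase κ hω k
  rw [sum_re_stepPhase, re_conj_phase_mul hω hz, sum_normSq_eq, hx, h, one_pow, mul_one,
    sub_self, Finset.sum_eq_zero_iff_of_nonneg] at hs
  swap
  · refine fun k _ => mul_nonneg (mul_nonneg ?_ ?_) (Complex.normSq_nonneg _)
    · exact (pathSin_pos (by omega) (by omega)).le
    · exact (pathSin_pos (by omega) (by omega)).le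
  have hω0 : ω ≠ 0 := by rintro rfl; simp at hω
  have hstep : ∀ k : Fin m, x k.succ / pathSin m (k + 2)
      = stepPhase κ ω k * (x k.castSucc / pathSin m (k + 1)) := by
    intro k
    have hk := hs k (Finset.mem_univ k)
    have h1 : 0 < pathSin m (k + 1) := pathSin_pos (by omega) (by omega)
    have h2 : 0 < pathSin m (k + 2) := pathSin_pos (by omega) (by omega)
    rw [mul_eq_zero, or_iff_right (mul_pos h1 h2).ne', Complex.normSq_eq_zero, sub_eq_zero] at hk
    exact hk
  set α : ℂ := x 0 / pathSin m 1 / ω ^ κ 0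
  have hα : ∀ j : Fin (m + 1), x j / pathSin m (j + 1) = α * ω ^ κ j := by
    intro j
    induction j using Fin.induction with
    | zero => simp [α, hω0]
    | succ k ih =>
      have := hstep k
      simp only [Fin.val_castSucc, Fin.val_succ] at ih ⊢
      rw [this, ih, mul_left_comm, stepPhase_mul_pow hκ hω]
  have hx' : ∀ j : Fin (m + 1), x j = α * (ω ^ κ j * pathSin m (j + 1)) := by
    intro j
    have h1 : (pathSin m (j + 1) : ℂ) ≠ 0 := by
      exact_mod_cast (pathSin_pos (m := m) (j := j + 1) (by omega) (by omega)).ne'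
    rw [← mul_assoc, ← hα j, div_mul_cancel₀ _ h1]
  refine ⟨α, ω, ?_, hω, hx'⟩
  intro h0
  have : x = 0 := by ext j; simp [hx' j, h0]
  simp [this] at hx

lemma stepForm_phase {m : ℕ} {κ : ℕ → ℕ} (hκ : IsZigzag κ) {ω : ℂ} (hω : ‖ω‖ = 1)
    (y : Fin (m + 1) → ℝ) :
    stepForm κ (fun j => ω ^ κ j * (y j : ℂ)) = (∑ k : Fin m, y k.castSucc * y k.succ : ℝ) * ω := by
  rw [stepForm, Complex.ofReal_sum, Finset.sum_mul]
  refine Finset.sum_congr rfl fun k _ => ?_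
  have hp : ∀ i : ℕ, conj ω ^ i * ω ^ i = 1 := fun i => by
    rw [← mul_pow, conj_mul_self_of_norm_one hω, one_pow]
  simp only [map_mul, map_pow, Complex.conj_ofReal, Fin.val_castSucc, Fin.val_succ]
  push_cast
  rcases hκ k with h | h
  · rw [if_pos h, h, pow_succ]
    linear_combination (y k.castSucc * y k.succ * ω : ℂ) * hp (κ k)
  · have h' : ¬ κ (k + 1) = κ k + 1 := by omega
    rw [if_neg h', h, pow_succ]
    linear_combination (y k.castSucc * y k.succ * ω : ℂ) * hp (κ (k + 1))

lemma sum_mul_succ_pathSin (m : ℕ) :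
    ∑ k : Fin m, pathSin m (k + 1) * pathSin m (k + 2) = pathRadius m * pathNormSq m := by
  have h := sum_path_weights m fun j => pathSin m (j + 1) ^ 2
  have e : ∀ k : Fin m, pathSin m (k + 1) / pathSin m (k + 2) * pathSin m ((k.succ : ℕ) + 1) ^ 2
      + pathSin m (k + 2) / pathSin m (k + 1) * pathSin m ((k.castSucc : ℕ) + 1) ^ 2
      = 2 * (pathSin m (k + 1) * pathSin m (k + 2)) := by
    intro k
    have h1 : 0 < pathSin m (k + 1) := pathSin_pos (by omega) (by omega)
    have h2 : 0 < pathSin m (k + 2) := pathSin_pos (by omega) (by omega)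
    simp only [Fin.val_castSucc, Fin.val_succ, add_assoc, Nat.reduceAdd]
    field_simp
    ring
  rw [Finset.sum_congr rfl fun k _ => e k, ← Finset.mul_sum] at h
  rw [pathNormSq]
  linarith

/-- The unit vector with entries `p` and `q` times those of the Perron vector at the even and at the
odd positions, twisted by the phases `ω ^ κ j`. -/
def twistedVec (m : ℕ) (κ : ℕ → ℕ) (ω : ℂ) (p q : ℝ) : EuclideanSpace ℂ (Fin (m + 1)) :=
  WithLp.toLp 2 fun j => ω ^ κ j *
    ((pathSin m (j + 1) * (if Even (j : ℕ) then p else q) / √(pathNormSq m) : ℝ) : ℂ)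

lemma norm_twistedVec {m : ℕ} (hm : 0 < m) (κ : ℕ → ℕ) {ω : ℂ} (hω : ‖ω‖ = 1) {p q : ℝ}
    (hpq : p ^ 2 + q ^ 2 = 2) : ‖twistedVec m κ ω p q‖ = 1 := by
  have h : ‖twistedVec m κ ω p q‖ ^ 2 = 1 := by
    rw [← sum_normSq_eq]
    have e : ∀ j : Fin (m + 1), Complex.normSq (twistedVec m κ ω p q j)
        = pathSin m (j + 1) ^ 2 * (if Even (j : ℕ) then p ^ 2 else q ^ 2) / pathNormSq m := by
      intro j
      have hR := (pathNormSq_pos m).le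
      simp only [twistedVec, map_mul, map_pow, Complex.normSq_eq_norm_sq ω, hω, one_pow, one_mul,
        Complex.normSq_ofReal]
      rw [div_mul_div_comm, Real.mul_self_sqrt hR]
      split_ifs <;> ring
    rw [Finset.sum_congr rfl fun j _ => e j, ← Finset.sum_div, sum_parity_weights hm, hpq]
    have := (pathNormSq_pos m).ne'
    field_simp
  exact (pow_eq_one_iff_of_nonneg (norm_nonneg _) two_ne_zero).mp h

lemma stepForm_twistedVec {m : ℕ} {κ : ℕ → ℕ} (hκ : IsZigzag κ) {ω : ℂ} (hω : ‖ω‖ = 1) (p q : ℝ) :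
    stepForm κ (twistedVec m κ ω p q) = ((p * q * pathRadius m : ℝ) : ℂ) * ω := by
  have h := stepForm_phase (m := m) hκ hω
    fun j => pathSin m (j + 1) * (if Even (j : ℕ) then p else q) / √(pathNormSq m)
  have hR := pathNormSq_pos m
  have e : ∀ k : Fin m,
      pathSin m ((k.castSucc : ℕ) + 1) * (if Even (k.castSucc : ℕ) then p else q)
          / √(pathNormSq m)
        * (pathSin m ((k.succ : ℕ) + 1) * (if Even (k.succ : ℕ) then p else q) / √(pathNormSq m))
      = p * q / pathNormSq m * (pathSin m (k + 1) * pathSin m (k + 2)) := by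
    intro k
    rw [div_mul_div_comm, Real.mul_self_sqrt hR.le]
    simp only [Fin.val_castSucc, Fin.val_succ, add_assoc, Nat.reduceAdd, Nat.even_add_one]
    by_cases hk : Even (k : ℕ) <;> simp [hk] <;> ring
  simp only [e] at h
  rw [← Finset.mul_sum, sum_mul_succ_pathSin] at h
  refine h.trans ?_
  congr 2
  field_simp

lemma image_stepForm {m : ℕ} (hm : 0 < m) {κ : ℕ → ℕ} (hκ : IsZigzag κ) :
    {z | ∃ x : EuclideanSpace ℂ (Fin (m + 1)), ‖x‖ = 1 ∧ stepForm κ x = z}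
      = Metric.closedBall 0 (pathRadius m) := by
  ext z
  rw [mem_closedBall_zero_iff]
  constructor
  · rintro ⟨x, hx, rfl⟩
    exact norm_stepForm_le κ hx
  · intro hz
    obtain ⟨ω, hω, hzω⟩ := exists_phase z
    have hr := pathRadius_pos hm
    set t := ‖z‖ / pathRadius m with ht
    have ht0 : 0 ≤ t := by positivity
    have ht1 : t ≤ 1 := (div_le_one hr).mpr hz
    have s1 : √(2 + 2 * t) ^ 2 = 2 + 2 * t := Real.sq_sqrt (by linarith)
    have s2 : √(2 - 2 * t) ^ 2 = 2 - 2 * t := Real.sq_sqrt (by linarith)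
    -- These weights solve `p² + q² = 2` and `p q = t`, since `(p ± q)² = 2 ± 2t`. The whole disc is
    -- filled explicitly, without an appeal to convexity.
    refine ⟨twistedVec m κ ω ((√(2 + 2 * t) + √(2 - 2 * t)) / 2)
      ((√(2 + 2 * t) - √(2 - 2 * t)) / 2), norm_twistedVec hm κ hω ?_, ?_⟩
    · linear_combination s1 / 2 + s2 / 2
    · rw [stepForm_twistedVec hκ hω]
      have : (√(2 + 2 * t) + √(2 - 2 * t)) / 2 * ((√(2 + 2 * t) - √(2 - 2 * t)) / 2) = t := by
        linear_combination s1 / 4 - s2 / 4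
      rw [this, ht, div_mul_cancel₀ _ hr.ne']
      exact hzω.symm

lemma numericalRange_zigzag {m : ℕ} (hm : 0 < m) {κ : ℕ → ℕ} (hκ : IsZigzag κ) (a b c : ℂ)
    (hbc : ‖b‖ ≠ ‖c‖) : numericalRange (zigzagToeplitz κ (m + 1) a b c)
      = affineConj a b c hbc '' Metric.closedBall 0 (pathRadius m) := by
  rw [← image_stepForm hm hκ]
  ext z
  constructor
  · rintro ⟨x, hx, rfl⟩
    exact ⟨_, ⟨x, hx, rfl⟩, (quadForm_zigzag hκ a b c hbc hx).symm⟩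
  · rintro ⟨_, ⟨x, hx, rfl⟩, rfl⟩
    exact ⟨x, hx, quadForm_zigzag hκ a b c hbc hx⟩

lemma quadForm_mem_frontier_iff {m : ℕ} (hm : 0 < m) {κ : ℕ → ℕ} (hκ : IsZigzag κ) (a b c : ℂ)
    (hbc : ‖b‖ ≠ ‖c‖) {x : EuclideanSpace ℂ (Fin (m + 1))} (hx : ‖x‖ = 1) :
    quadForm (zigzagToeplitz κ (m + 1) a b c) x
        ∈ frontier (numericalRange (zigzagToeplitz κ (m + 1) a b c))
      ↔ ‖stepForm κ x‖ = pathRadius m := by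
  rw [numericalRange_zigzag hm hκ a b c hbc, ← Homeomorph.image_frontier,
    quadForm_zigzag hκ a b c hbc hx, (affineConj a b c hbc).injective.mem_set_image,
    frontier_closedBall _ (pathRadius_pos hm).ne', mem_sphere_zero_iff_norm]

/-! ### Reducibility -/

/-- In an eigenbasis of `H`, entries of `A` between different eigenvalues vanish. One eigenspace and
the span of the others give the two blocks, both nonzero since `H` is not scalar. -/
lemma isUnitarilyReducible_of_commute {n : ℕ} {A H : Matrix (Fin n) (Fin n) ℂ}
    (hH : H.IsHermitian) (hAH : H * A = A * H) (hs : ∀ μ : ℂ, H ≠ μ • 1) :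
    IsUnitarilyReducible A := by
  classical
  have hn : 0 < n := by
    rcases Nat.eq_zero_or_pos n with rfl | h
    · exact absurd (Subsingleton.elim _ _) (hs 0)
    · exact h
  set U : Matrix (Fin n) (Fin n) ℂ := (hH.eigenvectorUnitary).1
    with hU
  have hUU : Uᴴ * U = 1 := Unitary.coe_star_mul_self hH.eigenvectorUnitary
  have hUU' : U * Uᴴ = 1 := Unitary.coe_mul_star_self hH.eigenvectorUnitary
  set d : Fin n → ℂ := fun i => (hH.eigenvalues i : ℂ) with hd
  have hspec : H = U * Matrix.diagonal d * Uᴴ := hH.spectral_theorem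
  have hcomm : Matrix.diagonal d * (Uᴴ * A * U) = Uᴴ * A * U * Matrix.diagonal d := by
    have hD : Matrix.diagonal d = Uᴴ * H * U := by
      rw [hspec]
      simp only [Matrix.mul_assoc, hUU, Matrix.mul_one]
      rw [← Matrix.mul_assoc, hUU, Matrix.one_mul]
    rw [hD]
    calc Uᴴ * H * U * (Uᴴ * A * U) = Uᴴ * (H * ((U * Uᴴ) * A)) * U := by
          simp only [Matrix.mul_assoc]
      _ = Uᴴ * (A * ((U * Uᴴ) * H)) * U := by rw [hUU', Matrix.one_mul, Matrix.one_mul, hAH]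
      _ = Uᴴ * A * U * (Uᴴ * H * U) := by simp only [Matrix.mul_assoc]
  have hzero : ∀ i j, d i ≠ d j → (Uᴴ * A * U) i j = 0 := by
    intro i j hij
    have h := congrFun (congrFun hcomm i) j
    rw [Matrix.diagonal_mul, Matrix.mul_diagonal] at h
    have : (d i - d j) * (Uᴴ * A * U) i j = 0 := by linear_combination h
    exact (mul_eq_zero.mp this).resolve_left (sub_ne_zero.mpr hij)
  set i₀ : Fin n := ⟨0, hn⟩
  obtain ⟨i₁, hi₁⟩ : ∃ i, d i ≠ d i₀ := by
    by_contra! hall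
    apply hs (d i₀)
    have : Matrix.diagonal d = d i₀ • (1 : Matrix (Fin n) (Fin n) ℂ) := by
      rw [Matrix.smul_one_eq_diagonal]
      congr 1
      exact funext hall
    rw [hspec, this, Matrix.mul_smul, Matrix.mul_one, Matrix.smul_mul, hUU']
  let P : Fin n → Prop := fun i => d i = d i₀
  let e : Fin (Fintype.card {i // P i}) ⊕ Fin (Fintype.card {i // ¬ P i}) ≃ Fin n :=
    (Equiv.sumCongr (Fintype.equivFin _).symm (Fintype.equivFin _).symm).trans (Equiv.sumCompl P)
  have hl : ∀ k, d (e (Sum.inl k)) = d i₀ := fun k => ((Fintype.equivFin {i // P i}).symm k).2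
  have hr : ∀ k, d (e (Sum.inr k)) ≠ d i₀ := fun k => ((Fintype.equivFin {i // ¬ P i}).symm k).2
  set M := Uᴴ * A * U
  refine ⟨_, _, Fintype.card_pos_iff.mpr ⟨⟨i₀, rfl⟩⟩, Fintype.card_pos_iff.mpr ⟨⟨i₁, hi₁⟩⟩, e, U,
    (Matrix.reindex e.symm e.symm M).toBlocks₁₁, (Matrix.reindex e.symm e.symm M).toBlocks₂₂,
    hH.eigenvectorUnitary.2, ?_⟩
  rw [← Equiv.symm_apply_eq]
  change Matrix.reindex e.symm e.symm M = _
  ext i j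
  rcases i with i | i <;> rcases j with j | j
  · rfl
  · exact hzero _ _ fun h => hr j (h.symm.trans (hl i))
  · exact hzero _ _ fun h => hr i (h.trans (hl j))
  · rfl

lemma exists_projection_of_isUnitarilyReducible {n : ℕ} {A : Matrix (Fin n) (Fin n) ℂ}
    (h : IsUnitarilyReducible A) : ∃ P : Matrix (Fin n) (Fin n) ℂ,
      P * A = A * P ∧ P * Aᴴ = Aᴴ * P ∧ ∀ μ : ℂ, P ≠ μ • 1 := by
  obtain ⟨p, q, hp, hq, e, U, B, C, hU, hA⟩ := h
  have hUU : Uᴴ * U = 1 := Matrix.mem_unitaryGroup_iff'.mp hU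
  have hUU' : U * Uᴴ = 1 := Matrix.mem_unitaryGroup_iff.mp hU
  set M := Matrix.reindex e e (Matrix.fromBlocks B 0 0 C) with hM
  set E : Matrix (Fin n) (Fin n) ℂ := Matrix.reindex e e (Matrix.fromBlocks 1 0 0 0) with hE
  have hAM : A = U * M * Uᴴ := by
    rw [← hA]
    calc A = (U * Uᴴ) * A * (U * Uᴴ) := by rw [hUU', Matrix.one_mul, Matrix.mul_one]
      _ = U * (Uᴴ * A * U) * Uᴴ := by simp only [Matrix.mul_assoc]
  have hEM : E * M = M * E := by
    simp only [hE, hM, Matrix.reindex_apply, Matrix.submatrix_mul_equiv, Matrix.fromBlocks_multiply]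
    simp
  have hEM' : E * Mᴴ = Mᴴ * E := by
    simp only [hE, hM, Matrix.reindex_apply, Matrix.conjTranspose_submatrix,
      Matrix.fromBlocks_conjTranspose, Matrix.submatrix_mul_equiv, Matrix.fromBlocks_multiply]
    simp
  have hconj : ∀ X Y : Matrix (Fin n) (Fin n) ℂ,
      U * X * Uᴴ * (U * Y * Uᴴ) = U * (X * Y) * Uᴴ := by
    intro X Y
    calc U * X * Uᴴ * (U * Y * Uᴴ) = U * X * (Uᴴ * U) * Y * Uᴴ := by simp only [Matrix.mul_assoc]
      _ = U * (X * Y) * Uᴴ := by rw [hUU, Matrix.mul_one, Matrix.mul_assoc U X Y]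
  refine ⟨U * E * Uᴴ, ?_, ?_, ?_⟩
  · rw [hAM, hconj, hconj, hEM]
  · have : Aᴴ = U * Mᴴ * Uᴴ := by
      rw [hAM]
      simp only [Matrix.conjTranspose_mul, Matrix.conjTranspose_conjTranspose, Matrix.mul_assoc]
    rw [this, hconj, hconj, hEM']
  · intro μ hμ
    have hEμ : E = μ • 1 := by
      calc E = (Uᴴ * U) * E * (Uᴴ * U) := by rw [hUU, Matrix.one_mul, Matrix.mul_one]
        _ = Uᴴ * (U * E * Uᴴ) * U := by simp only [Matrix.mul_assoc]
        _ = μ • 1 := by rw [hμ, Matrix.mul_smul, Matrix.mul_one, Matrix.smul_mul, hUU]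
    have h1 := congrFun (congrFun hEμ (e (Sum.inl ⟨0, hp⟩))) (e (Sum.inl ⟨0, hp⟩))
    have h2 := congrFun (congrFun hEμ (e (Sum.inr ⟨0, hq⟩))) (e (Sum.inr ⟨0, hq⟩))
    simp [hE] at h1 h2
    exact one_ne_zero (h1.trans h2.symm)

/-- The `0`-`1` matrix of the upward steps of `κ`. -/
abbrev stepMatrix (κ : ℕ → ℕ) (n : ℕ) : Matrix (Fin n) (Fin n) ℂ := zigzagToeplitz κ n 0 1 0

lemma stepMatrix_conjTranspose {κ : ℕ → ℕ} (hκ : IsZigzag κ) (n : ℕ) :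
    (stepMatrix κ n)ᴴ = zigzagToeplitz κ n 0 0 1 := by
  ext i j
  simp only [stepMatrix, zigzagToeplitz, Matrix.conjTranspose_apply, Matrix.of_apply]
  by_cases hij : i = j
  · simp [hij]
  have hji : ¬ j = i := fun h => hij h.symm
  simp only [hij, hji, if_false]
  by_cases h : (i : ℕ) + 1 = j ∨ (j : ℕ) + 1 = i
  · have hz : κ j = κ i + 1 ∨ κ i = κ j + 1 := by
      rcases h with h | h
      · rw [← h]; exact hκ i
      · rw [← h]; exact (hκ j).symm
    rw [if_pos h, if_pos h.symm]
    rcases hz with hz | hz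
    · have : ¬ κ i = κ j + 1 := by omega
      rw [if_pos hz, if_neg this]; simp
    · have : ¬ κ j = κ i + 1 := by omega
      rw [if_neg this, if_pos hz]; simp
  · have h' : ¬ ((j : ℕ) + 1 = i ∨ (i : ℕ) + 1 = j) := fun h' => h h'.symm
    simp [h, h']

lemma zigzagToeplitz_eq_add {κ : ℕ → ℕ} (hκ : IsZigzag κ) (n : ℕ) (a b c : ℂ) :
    zigzagToeplitz κ n a b c = a • 1 + b • stepMatrix κ n + c • (stepMatrix κ n)ᴴ := by
  rw [stepMatrix_conjTranspose hκ]
  ext i j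
  by_cases hij : i = j
  · simp [zigzagToeplitz, hij]
  · by_cases h : (i : ℕ) + 1 = j ∨ (j : ℕ) + 1 = i
    · by_cases hz : κ j = κ i + 1 <;> simp [zigzagToeplitz, hij, h, hz]
    · simp [zigzagToeplitz, hij, h]

lemma stepMatrix_id_apply {n : ℕ} (i j : Fin n) :
    stepMatrix id n i j = if (i : ℕ) + 1 = j then 1 else 0 := by
  simp only [stepMatrix, zigzagToeplitz, Matrix.of_apply, id]
  split_ifs <;> first | rfl | omega

/-- Commuting with the shift makes `P` constant along diagonals and clears its first column below
the corner; the same argument for `Pᴴ` clears the first row. -/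
lemma eq_smul_one_of_commute_shift {m : ℕ} {P : Matrix (Fin (m + 1)) (Fin (m + 1)) ℂ}
    (h1 : P * stepMatrix id (m + 1) = stepMatrix id (m + 1) * P)
    (h2 : P * (stepMatrix id (m + 1))ᴴ = (stepMatrix id (m + 1))ᴴ * P) : P = P 0 0 • 1 := by
  have hR : ∀ (X : Matrix (Fin (m + 1)) (Fin (m + 1)) ℂ) i (k : Fin m),
      (X * stepMatrix id (m + 1)) i k.succ = X i k.castSucc := by
    intro X i k
    rw [Matrix.mul_apply, Finset.sum_eq_single k.castSucc]
    · simp [stepMatrix_id_apply]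
    · intro l _ hl
      rw [stepMatrix_id_apply, if_neg, mul_zero]
      exact fun h => hl (Fin.ext (by simpa using h))
    · simp
  have hR0 : ∀ (X : Matrix (Fin (m + 1)) (Fin (m + 1)) ℂ) i,
      (X * stepMatrix id (m + 1)) i 0 = 0 := by
    intro X i
    rw [Matrix.mul_apply]
    refine Finset.sum_eq_zero fun l _ => ?_
    rw [stepMatrix_id_apply, if_neg (by simp), mul_zero]
  have hL : ∀ (X : Matrix (Fin (m + 1)) (Fin (m + 1)) ℂ) (k : Fin m) j,
      (stepMatrix id (m + 1) * X) k.castSucc j = X k.succ j := by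
    intro X k j
    rw [Matrix.mul_apply, Finset.sum_eq_single k.succ]
    · simp [stepMatrix_id_apply]
    · intro l _ hl
      rw [stepMatrix_id_apply, if_neg, zero_mul]
      exact fun h => hl (Fin.ext (by simpa using h.symm))
    · simp
  have h3 : Pᴴ * stepMatrix id (m + 1) = stepMatrix id (m + 1) * Pᴴ := by
    have := congrArg Matrix.conjTranspose h2
    simpa only [Matrix.conjTranspose_mul, Matrix.conjTranspose_conjTranspose] using this.symm
  have hcol : ∀ k : Fin m, P k.succ 0 = 0 := fun k => by
    rw [← hL P, ← h1, hR0]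
  have hrow : ∀ k : Fin m, P 0 k.succ = 0 := fun k => by
    have : Pᴴ k.succ 0 = 0 := by rw [← hL Pᴴ, ← h3, hR0]
    simpa using this
  have hstep : ∀ k l : Fin m, P k.succ l.succ = P k.castSucc l.castSucc := fun k l => by
    rw [← hL P, ← h1, hR]
  ext i j
  induction i using Fin.induction generalizing j with
  | zero =>
    refine Fin.cases ?_ (fun l => ?_) j
    · simp
    · rw [hrow]; simp [(Fin.succ_ne_zero l).symm]
  | succ k ih =>
    refine Fin.cases ?_ (fun l => ?_) j
    · rw [hcol]; simp
    · rw [hstep, ih]; simp [Matrix.one_apply]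

lemma isUnitarilyIrreducible_zigzag_id (m : ℕ) (a b c : ℂ) (hbc : ‖b‖ ≠ ‖c‖) :
    IsUnitarilyIrreducible (zigzagToeplitz id (m + 1) a b c) := by
  intro hred
  obtain ⟨P, h1, h2, hP⟩ := exists_projection_of_isUnitarilyReducible hred
  have hne := conj_mul_self_sub_ne_zero hbc
  rw [zigzagToeplitz_eq_add isZigzag_id] at h1 h2
  set S := stepMatrix id (m + 1)
  simp only [Matrix.conjTranspose_add, Matrix.conjTranspose_smul, Matrix.conjTranspose_one,
    Matrix.conjTranspose_conjTranspose, Matrix.mul_add, Matrix.add_mul, Matrix.mul_smul,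
    Matrix.smul_mul, Matrix.mul_one, Matrix.one_mul, Complex.star_def, add_assoc,
    add_right_inj] at h1 h2
  -- Eliminating `Sᴴ` from the relations for the matrix and its adjoint leaves the determinant `|b|²
  -- - |c|²`, which is nonzero.
  have key1 : (conj b * b - conj c * c) • (P * S - S * P) = 0 := by
    have h : conj b • (b • (P * S) + c • (P * Sᴴ)) - c • (conj b • (P * Sᴴ) + conj c • (P * S))
        = conj b • (b • (S * P) + c • (Sᴴ * P)) - c • (conj b • (Sᴴ * P) + conj c • (S * P)) := by
      rw [h1, h2]
    rw [← sub_eq_zero] at h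
    rw [← h]
    module
  have key2 : (conj b * b - conj c * c) • (P * Sᴴ - Sᴴ * P) = 0 := by
    have h : b • (conj b • (P * Sᴴ) + conj c • (P * S)) - conj c • (b • (P * S) + c • (P * Sᴴ))
        = b • (conj b • (Sᴴ * P) + conj c • (S * P)) - conj c • (b • (S * P) + c • (Sᴴ * P)) := by
      rw [h1, h2]
    rw [← sub_eq_zero] at h
    rw [← h]
    module
  exact hP _ (eq_smul_one_of_commute_shift
    (sub_eq_zero.mp ((smul_eq_zero.mp key1).resolve_left hne))
    (sub_eq_zero.mp ((smul_eq_zero.mp key2).resolve_left hne)))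

lemma stepMatrix_alternation_apply {n : ℕ} (i j : Fin n) : stepMatrix alternation n i j
    = if ((i : ℕ) + 1 = j ∨ (j : ℕ) + 1 = i) ∧ ¬ Even (i : ℕ) ∧ Even (j : ℕ) then 1 else 0 := by
  simp only [stepMatrix, zigzagToeplitz, Matrix.of_apply, alternation]
  by_cases hij : i = j
  · subst hij; simp
  · by_cases hi : Even (i : ℕ) <;> by_cases hj : Even (j : ℕ) <;> simp [hij, hi, hj]

/-- Nonzero entries lie in odd rows and even columns (counted from `0`), so no two of them compose.
-/
lemma stepMatrix_alternation_mul_self (n : ℕ) :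
    stepMatrix alternation n * stepMatrix alternation n = 0 := by
  ext i j
  rw [Matrix.mul_apply]
  refine Finset.sum_eq_zero fun k _ => ?_
  rw [stepMatrix_alternation_apply, stepMatrix_alternation_apply]
  by_cases h : Even (k : ℕ) <;> simp [h]

lemma isUnitarilyReducible_zigzag_alternation {m : ℕ} (hm : 2 ≤ m) (a b c : ℂ) :
    IsUnitarilyReducible (zigzagToeplitz alternation (m + 1) a b c) := by
  set S := stepMatrix alternation (m + 1) with hS
  have hSS : S * S = 0 := stepMatrix_alternation_mul_self _
  have hTT : Sᴴ * Sᴴ = 0 := by rw [← Matrix.conjTranspose_mul, hSS, Matrix.conjTranspose_zero]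
  have hH : (S * Sᴴ + Sᴴ * S).IsHermitian :=
    (Matrix.isHermitian_mul_conjTranspose_self S).add (Matrix.isHermitian_conjTranspose_mul_self S)
  refine isUnitarilyReducible_of_commute hH ?_ ?_
  · rw [zigzagToeplitz_eq_add isZigzag_alternation, ← hS]
    have h1 : (S * Sᴴ + Sᴴ * S) * S = S * (S * Sᴴ + Sᴴ * S) := by
      rw [Matrix.add_mul, Matrix.mul_add, Matrix.mul_assoc Sᴴ, hSS, ← Matrix.mul_assoc S S, hSS]
      simp [Matrix.mul_assoc]
    have h2 : (S * Sᴴ + Sᴴ * S) * Sᴴ = Sᴴ * (S * Sᴴ + Sᴴ * S) := by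
      rw [Matrix.add_mul, Matrix.mul_add, Matrix.mul_assoc S, hTT, ← Matrix.mul_assoc Sᴴ Sᴴ, hTT]
      simp [Matrix.mul_assoc]
    rw [Matrix.mul_add (S * Sᴴ + Sᴴ * S), Matrix.mul_add (S * Sᴴ + Sᴴ * S),
      Matrix.add_mul _ _ (S * Sᴴ + Sᴴ * S),
      Matrix.add_mul _ _ (S * Sᴴ + Sᴴ * S)]
    rw [Matrix.mul_smul _ a, Matrix.mul_smul _ b, Matrix.mul_smul _ c, h1, h2, Matrix.mul_one,
      Matrix.smul_mul a, Matrix.smul_mul b, Matrix.smul_mul c, Matrix.one_mul]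
  · intro μ hμ
    -- The vertices `0` and `2` share the neighbour `1`, which produces an off-diagonal `1` in `Sᴴ *
    -- S`.
    have h02 := congrFun (congrFun hμ ⟨0, by omega⟩) ⟨2, by omega⟩
    have h1 : ∑ k, S ⟨0, by omega⟩ k * Sᴴ k ⟨2, by omega⟩ = 0 := by
      refine Finset.sum_eq_zero fun k _ => ?_
      rw [hS, stepMatrix_alternation_apply, if_neg (by simp), zero_mul]
    have h2 : ∑ k, Sᴴ ⟨0, by omega⟩ k * S k ⟨2, by omega⟩ = 1 := by
      rw [Finset.sum_eq_single (⟨1, by omega⟩ : Fin (m + 1))]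
      · rw [Matrix.conjTranspose_apply, hS, stepMatrix_alternation_apply,
          stepMatrix_alternation_apply, if_pos (by simp), if_pos (by simp)]
        simp
      · intro k _ hk
        have hk1 : (k : ℕ) ≠ 1 := fun h => hk (Fin.ext h)
        rw [Matrix.conjTranspose_apply, hS, stepMatrix_alternation_apply, if_neg, star_zero,
          zero_mul]
        rintro ⟨h | h, -⟩
        · simp at h
        · exact hk1 (by simpa using h.symm)
      · simp
    rw [Matrix.add_apply, Matrix.mul_apply, Matrix.mul_apply, h1, h2, Matrix.smul_apply,
      Matrix.one_apply_ne (by simp)] at h02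
    simp at h02

/-! ### The base polynomial -/

lemma det_zigzag_pencil {R : Type*} [CommRing R] [IsDomain R] {n : ℕ} {β γ : R} (hβ : β ≠ 0)
    (hγ : γ ≠ 0) {M M' : Matrix (Fin n) (Fin n) R}
    (hd : ∀ i, M' i i = M i i)
    (hM : ∀ i j : Fin n, (i : ℕ) + 1 = j → M i j = β ∧ M j i = γ)
    (heven : ∀ i j : Fin n, (i : ℕ) + 1 = j → Even (i : ℕ) → M' i j = γ ∧ M' j i = β)
    (hodd : ∀ i j : Fin n, (i : ℕ) + 1 = j → ¬ Even (i : ℕ) → M' i j = β ∧ M' j i = γ)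
    (h0 : ∀ i j : Fin n, i ≠ j → (i : ℕ) + 1 ≠ j → (j : ℕ) + 1 ≠ i → M i j = 0 ∧ M' i j = 0) :
    M.det = M'.det := by
  -- The conjugating diagonal must change by the factor `β / γ` across each swapped edge and stay
  -- constant across the others; the complementary power of `γ` avoids division.
  set d : Fin n → R := fun i => β ^ (((i : ℕ) + 1) / 2) * γ ^ (n - ((i : ℕ) + 1) / 2) with hdd
  have hd0 : (Matrix.diagonal d).det ≠ 0 := by
    rw [Matrix.det_diagonal]
    exact Finset.prod_ne_zero_iff.mpr fun i _ => mul_ne_zero (pow_ne_zero _ hβ) (pow_ne_zero _ hγ)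
  have hde : ∀ i j : Fin n, (i : ℕ) + 1 = j → Even (i : ℕ) → d i * β = γ * d j := by
    intro i j hij h
    have e1 : ((j : ℕ) + 1) / 2 = ((i : ℕ) + 1) / 2 + 1 := by
      obtain ⟨k, hk⟩ := h; omega
    have e2 : n - ((i : ℕ) + 1) / 2 = n - (((i : ℕ) + 1) / 2 + 1) + 1 := by omega
    simp only [hdd]
    rw [e1, e2, pow_succ, pow_succ]
    ring
  have hdo : ∀ i j : Fin n, (i : ℕ) + 1 = j → ¬ Even (i : ℕ) → d i = d j := by
    intro i j hij h
    have e1 : ((j : ℕ) + 1) / 2 = ((i : ℕ) + 1) / 2 := by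
      obtain ⟨k, hk⟩ := Nat.not_even_iff_odd.mp h; omega
    simp only [hdd]
    rw [e1]
  have hsim : Matrix.diagonal d * M = M' * Matrix.diagonal d := by
    ext i j
    rw [Matrix.diagonal_mul, Matrix.mul_diagonal]
    by_cases hij : i = j
    · subst hij
      rw [hd, mul_comm]
    by_cases h1 : (i : ℕ) + 1 = j
    · by_cases he : Even (i : ℕ)
      · rw [(hM i j h1).1, (heven i j h1 he).1, hde i j h1 he]
      · rw [(hM i j h1).1, (hodd i j h1 he).1, hdo i j h1 he, mul_comm]
    by_cases h2 : (j : ℕ) + 1 = i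
    · by_cases he : Even (j : ℕ)
      · rw [(hM j i h2).2, (heven j i h2 he).2, mul_comm β, hde j i h2 he, mul_comm]
      · rw [(hM j i h2).2, (hodd j i h2 he).2, hdo j i h2 he, mul_comm]
    · rw [(h0 i j hij h1 h2).1, (h0 i j hij h1 h2).2, mul_zero, zero_mul]
  have := congrArg Matrix.det hsim
  rw [Matrix.det_mul, Matrix.det_mul, mul_comm M'.det] at this
  exact mul_left_cancel₀ hd0 this

/-- The entry of `x Re A + y Im A` where `A` has the entry `u` there and `v` in the mirrored
position. -/
def pencilEntry (u v : ℂ) : MvPolynomial (Fin 3) ℂ :=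
  MvPolynomial.X 0 * MvPolynomial.C (1 / 2 * (u + conj v))
    + MvPolynomial.X 1 * MvPolynomial.C (1 / (2 * Complex.I) * (u - conj v))

/-- The coefficient of `x` is `(u + v̄)/2`. Nonvanishing lets the determinant of the conjugating
diagonal be cancelled. -/
lemma pencilEntry_ne_zero {u v : ℂ} (h : ‖u‖ ≠ ‖v‖) : pencilEntry u v ≠ 0 := by
  intro h0
  have := congrArg (MvPolynomial.eval ![1, 0, 0]) h0
  simp [pencilEntry] at this
  apply h
  rw [eq_neg_of_add_eq_zero_left this, norm_neg, Complex.norm_conj]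

lemma basePolynomial_tridiagToeplitz (n : ℕ) (a b c : ℂ) (hbc : ‖b‖ ≠ ‖c‖) :
    basePolynomial (tridiagToeplitz n a b c)
      = basePolynomial (swapOdd (tridiagToeplitz n a b c)) := by
  rw [basePolynomial, basePolynomial]
  set pencil : Matrix (Fin n) (Fin n) ℂ → Matrix (Fin n) (Fin n) (MvPolynomial (Fin 3) ℂ) :=
    fun A => (MvPolynomial.X 0 : MvPolynomial (Fin 3) ℂ) • (rePart A).map MvPolynomial.C
      + (MvPolynomial.X 1 : MvPolynomial (Fin 3) ℂ) • (imPart A).map MvPolynomial.C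
      + (MvPolynomial.X 2 : MvPolynomial (Fin 3) ℂ) •
          (1 : Matrix (Fin n) (Fin n) (MvPolynomial (Fin 3) ℂ)) with hp
  have hoff : ∀ A i j, i ≠ j → pencil A i j = pencilEntry (A i j) (A j i) := by
    intro A i j hij
    simp [hp, rePart, imPart, pencilEntry, hij]
    ring
  have hdiag : ∀ A i, pencil A i i = pencilEntry (A i i) (A i i) + MvPolynomial.X 2 := by
    intro A i
    simp [hp, rePart, imPart, pencilEntry]
    ring
  set A := tridiagToeplitz n a b c with hA
  have hup : ∀ i j : Fin n, (i : ℕ) + 1 = j → i ≠ j ∧ A i j = b ∧ A j i = c := by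
    intro i j hij
    have h1 : i ≠ j := fun h => by rw [h] at hij; omega
    have h2 : ¬ (j : ℕ) + 1 = i := by omega
    exact ⟨h1, by simp [hA, tridiagToeplitz, h1, hij],
      by simp [hA, tridiagToeplitz, h1.symm, h2, hij]⟩
  refine det_zigzag_pencil (pencilEntry_ne_zero hbc) (pencilEntry_ne_zero hbc.symm)
    (M := pencil A) (M' := pencil (swapOdd A)) ?_ ?_ ?_ ?_ ?_
  · intro i
    rw [hdiag, hdiag]
    simp [swapOdd]
  · intro i j hij
    obtain ⟨h1, h2, h3⟩ := hup i j hij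
    rw [hoff _ _ _ h1, hoff _ _ _ h1.symm, h2, h3]
    exact ⟨rfl, rfl⟩
  · intro i j hij he
    obtain ⟨h1, h2, h3⟩ := hup i j hij
    rw [hoff _ _ _ h1, hoff _ _ _ h1.symm]
    simp [swapOdd, he, hij, h2, h3]
  · intro i j hij he
    obtain ⟨h1, h2, h3⟩ := hup i j hij
    have h4 : ¬ (j : ℕ) + 1 = i := by omega
    rw [hoff _ _ _ h1, hoff _ _ _ h1.symm]
    simp [swapOdd, he, h4, h2, h3]
  · intro i j hij h1 h2
    rw [hoff _ _ _ hij, hoff _ _ _ hij]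
    have h3 : A i j = 0 := by simp [hA, tridiagToeplitz, hij, h1, h2]
    have h4 : A j i = 0 := by simp [hA, tridiagToeplitz, hij.symm, h1, h2]
    simp [swapOdd, h1, h2, h3, h4, pencilEntry]

/-! ### Gau–Wu numbers -/

lemma inner_of_phase {m : ℕ} {κ : ℕ → ℕ} {x y : EuclideanSpace ℂ (Fin (m + 1))} {α β ω ξ : ℂ}
    (hx : ∀ j : Fin (m + 1), x j = α * (ω ^ κ j * pathSin m (j + 1)))
    (hy : ∀ j : Fin (m + 1), y j = β * (ξ ^ κ j * pathSin m (j + 1))) :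
    inner ℂ x y = conj α * β *
      ∑ j : Fin (m + 1), ((pathSin m (j + 1) ^ 2 : ℝ) : ℂ) * (conj ω * ξ) ^ κ j := by
  rw [PiLp.inner_apply, Finset.mul_sum]
  refine Finset.sum_congr rfl fun j _ => ?_
  rw [RCLike.inner_apply, hx, hy]
  simp only [map_mul, map_pow, Complex.conj_ofReal, mul_pow]
  push_cast
  ring

lemma twistedVec_one_one (m : ℕ) (κ : ℕ → ℕ) (ω : ℂ) (j : Fin (m + 1)) :
    twistedVec m κ ω 1 1 j = ((√(pathNormSq m))⁻¹ : ℝ) * (ω ^ κ j * pathSin m (j + 1)) := by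
  simp only [twistedVec, ite_self, mul_one]
  push_cast
  ring

/-- With the converse `exists_phases_of_mem`, this turns the Gau–Wu number into the largest number
of unit phases whose pairwise ratios are zeros of one power sum. -/
lemma mem_boundaryOrthonormalSizes {m k : ℕ} (hm : 0 < m) {κ : ℕ → ℕ} (hκ : IsZigzag κ)
    (a b c : ℂ) (hbc : ‖b‖ ≠ ‖c‖) (ω : Fin k → ℂ) (hω : ∀ i, ‖ω i‖ = 1)
    (h : ∀ i j, i ≠ j →
      ∑ l : Fin (m + 1), ((pathSin m (l + 1) ^ 2 : ℝ) : ℂ) * (conj (ω i) * ω j) ^ κ l = 0) :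
    k ∈ boundaryOrthonormalSizes (zigzagToeplitz κ (m + 1) a b c) := by
  have hn : ∀ i, ‖twistedVec m κ (ω i) 1 1‖ = 1 := fun i =>
    norm_twistedVec hm κ (hω i) (by norm_num)
  refine ⟨fun i => twistedVec m κ (ω i) 1 1, ⟨hn, fun i j hij => ?_⟩, fun i => ?_⟩
  · change inner ℂ _ _ = (0 : ℂ)
    rw [inner_of_phase (twistedVec_one_one m κ (ω i)) (twistedVec_one_one m κ (ω j)), h i j hij,
      mul_zero]
  · rw [quadForm_mem_frontier_iff hm hκ a b c hbc (hn i), stepForm_twistedVec hκ (hω i), norm_mul,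
      hω i, Complex.norm_real, Real.norm_of_nonneg] <;> simp [(pathRadius_pos hm).le]

lemma exists_phases_of_mem {m k : ℕ} (hm : 0 < m) {κ : ℕ → ℕ} (hκ : IsZigzag κ)
    (a b c : ℂ) (hbc : ‖b‖ ≠ ‖c‖)
    (hk : k ∈ boundaryOrthonormalSizes (zigzagToeplitz κ (m + 1) a b c)) :
    ∃ ω : Fin k → ℂ, (∀ i, ‖ω i‖ = 1) ∧ ∀ i j, i ≠ j →
      ∑ l : Fin (m + 1), ((pathSin m (l + 1) ^ 2 : ℝ) : ℂ) * (conj (ω i) * ω j) ^ κ l = 0 := by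
  obtain ⟨x, hx, hb⟩ := hk
  have h := fun i => exists_phase_of_norm_stepForm_eq hκ (hx.1 i)
    ((quadForm_mem_frontier_iff hm hκ a b c hbc (hx.1 i)).mp (hb i))
  choose α ω hα hω hxω using h
  refine ⟨ω, hω, fun i j hij => ?_⟩
  have h0 : inner ℂ (x i) (x j) = 0 := hx.2 hij
  rw [inner_of_phase (hxω i) (hxω j)] at h0
  refine (mul_eq_zero.mp h0).resolve_left (mul_ne_zero ?_ (hα j))
  exact (map_ne_zero _).mpr (hα i)

lemma sum_alternation {m : ℕ} (hm : 0 < m) (z : ℂ) :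
    ∑ l : Fin (m + 1), ((pathSin m (l + 1) ^ 2 : ℝ) : ℂ) * z ^ alternation l
      = pathNormSq m / 2 * (z + 1) := by
  have h1 := congrArg (fun t : ℝ => (t : ℂ)) (sum_parity_weights hm 1 0)
  have h2 := congrArg (fun t : ℝ => (t : ℂ)) (sum_parity_weights hm 0 1)
  simp only [Complex.ofReal_sum, Complex.ofReal_mul] at h1 h2
  have e : ∀ l : Fin (m + 1), ((pathSin m (l + 1) ^ 2 : ℝ) : ℂ) * z ^ alternation l
      = ((pathSin m (l + 1) ^ 2 : ℝ) : ℂ) * ((if Even (l : ℕ) then 1 else 0 : ℝ) : ℂ) * z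
        + ((pathSin m (l + 1) ^ 2 : ℝ) : ℂ) * ((if Even (l : ℕ) then 0 else 1 : ℝ) : ℂ) := by
    intro l
    by_cases hl : Even (l : ℕ) <;> simp [alternation, hl]
  rw [Finset.sum_congr rfl fun l _ => e l, Finset.sum_add_distrib, ← Finset.sum_mul, h1, h2]
  push_cast
  ring

lemma eq_neg_of_conj_mul {ω ξ : ℂ} (hω : ‖ω‖ = 1) (h : conj ω * ξ = -1) : ξ = -ω := by
  have := conj_mul_self_of_norm_one hω
  linear_combination ω * h - ξ * this

lemma gauWuNumber_alternation {m : ℕ} (hm : 0 < m) (a b c : ℂ) (hbc : ‖b‖ ≠ ‖c‖) :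
    gauWuNumber (zigzagToeplitz alternation (m + 1) a b c) = 2 := by
  refine (isGreatest_gauWuNumber _).unique ⟨?_, fun k hk => ?_⟩
  · refine mem_boundaryOrthonormalSizes hm isZigzag_alternation a b c hbc ![1, -1] ?_ ?_
    · intro i; fin_cases i <;> simp
    · intro i j hij
      rw [sum_alternation hm]
      fin_cases i <;> fin_cases j <;> simp at hij ⊢
  · obtain ⟨ω, hω, h⟩ := exists_phases_of_mem hm isZigzag_alternation a b c hbc hk
    by_contra! hk2
    have hR : (pathNormSq m : ℂ) / 2 ≠ 0 := by
      have : (pathNormSq m : ℂ) ≠ 0 := by exact_mod_cast (pathNormSq_pos m).ne'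
      exact div_ne_zero this two_ne_zero
    have hneg : ∀ i j, i ≠ j → ω j = -ω i := by
      intro i j hij
      have h0 := h i j hij
      rw [sum_alternation hm, mul_eq_zero, or_iff_right hR] at h0
      exact eq_neg_of_conj_mul (hω i) (eq_neg_of_add_eq_zero_left h0)
    have h1 := hneg ⟨0, by omega⟩ ⟨1, by omega⟩ (by simp)
    have h2 := hneg ⟨0, by omega⟩ ⟨2, by omega⟩ (by simp)
    have h3 := hneg ⟨1, by omega⟩ ⟨2, by omega⟩ (by simp)
    -- Three numbers that are pairwise negatives of each other must vanish.
    have h4 : ω ⟨0, by omega⟩ = 0 := by linear_combination (h1 + h2 - h3) / 2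
    have h5 := hω ⟨0, by omega⟩
    rw [h4] at h5
    simp at h5

lemma sum_id_eq_zero_iff {m : ℕ} {z : ℂ} (hz : z ≠ 0) :
    ∑ l : Fin (m + 1), ((pathSin m (l + 1) ^ 2 : ℝ) : ℂ) * z ^ id (l : ℕ) = 0
      ↔ pathPoly m z = 0 := by
  rw [← sum_pathSin_sq_mul_pow, mul_eq_zero, or_iff_right hz]
  rfl

lemma norm_pathRoot (m : ℕ) : ‖pathRoot m‖ = 1 :=
  (pathRoot_isPrimitive m).norm'_eq_one (by omega)

/-- If all phases have the same `(m + 2)`-th power, then they and their multiples by `q` are `2 * k`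
distinct roots of one equation of degree `m + 2`, as the ratio `q` is forbidden. -/
lemma card_le_of_pathPoly_eq_zero {m k : ℕ} (hm : 2 ≤ m) {ω : Fin k → ℂ} (hω : ∀ i, ‖ω i‖ = 1)
    (h : ∀ i j, i ≠ j → pathPoly m (conj (ω i) * ω j) = 0) : 2 * k ≤ m + 2 := by
  classical
  have hω0 : ∀ i, ω i ≠ 0 := fun i h0 => by simpa [h0] using hω i
  have hc0 : ∀ i, conj (ω i) ≠ 0 := fun i => (map_ne_zero _).mpr (hω0 i)
  have hq := (pathRoot_isPrimitive m).pow_eq_one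
  have hq0 : pathRoot m ≠ 0 := (pathRoot_isPrimitive m).ne_zero (by omega)
  have hinv : ∀ i, conj (ω i) * ω i = 1 := fun i => conj_mul_self_of_norm_one (hω i)
  have hdich : ∀ i j, i ≠ j → ω j ^ (m + 2) = ω i ^ (m + 2) ∨ ω j = -ω i := by
    intro i j hij
    rcases eq_neg_one_or_pow_eq_one_of_pathPoly_eq_zero (mul_ne_zero (hc0 i) (hω0 j)) (h i j hij)
      with h1 | h1
    · left
      calc ω j ^ (m + 2) = (conj (ω i) * ω i) ^ (m + 2) * ω j ^ (m + 2) := by rw [hinv]; simp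
        _ = (conj (ω i) * ω j) ^ (m + 2) * ω i ^ (m + 2) := by rw [← mul_pow, ← mul_pow]; ring
        _ = ω i ^ (m + 2) := by rw [h1, one_mul]
    · exact Or.inr (eq_neg_of_conj_mul (hω i) h1)
  have hdist : ∀ i j, pathPoly m (conj (ω i) * ω j) = 0 → ω j ≠ ω i := by
    intro i j h0 hij
    rw [hij, hinv] at h0
    have : pathPoly m 1 = pathNormSq m := by
      rw [← sum_pathSin_sq_mul_pow, pathNormSq]
      simp
    rw [this] at h0
    exact (pathNormSq_pos m).ne' (by exact_mod_cast h0)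
  by_cases hall : ∃ μ, μ ≠ 0 ∧ ∀ i, ω i ^ (m + 2) = μ
  · obtain ⟨μ, hμ, hall⟩ := hall
    have hinj : Function.Injective ω := by
      intro i j hij
      by_contra hne
      exact hdist i j (h i j hne) hij.symm
    have hne : ∀ i j, ω j ≠ pathRoot m * ω i := by
      intro i j hij
      by_cases hne : i = j
      · subst hne
        refine pathRoot_ne_one m (mul_right_cancel₀ (hω0 i) ?_)
        rw [one_mul]
        exact hij.symm
      · have h0 := h i j hne
        rw [hij, mul_left_comm, hinv, mul_one] at h0
        exact pathPoly_pathRoot_ne_zero (by omega) h0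
    have hf : Function.Injective (Sum.elim ω fun i => pathRoot m * ω i) := by
      refine hinj.sumElim ?_ fun i j => ?_
      · intro i j hij
        exact hinj (mul_left_cancel₀ hq0 hij)
      · exact hne j i
    have hsub : Finset.univ.image (Sum.elim ω fun i => pathRoot m * ω i)
        ⊆ (Polynomial.nthRoots (m + 2) μ).toFinset := by
      intro z hz
      obtain ⟨i, -, rfl⟩ := Finset.mem_image.mp hz
      rw [Multiset.mem_toFinset, Polynomial.mem_nthRoots (by omega)]
      rcases i with i | i
      · exact hall i
      · simp only [Sum.elim_inr]
        rw [mul_pow, hq, one_mul, hall]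
    have hcard := Finset.card_le_card hsub
    rw [Finset.card_image_of_injective _ hf, Finset.card_univ, Fintype.card_sum,
      Fintype.card_fin] at hcard
    have := (Multiset.toFinset_card_le _).trans (Polynomial.card_nthRoots (m + 2) μ)
    omega
  -- Here two phases with different powers are antipodal. A third would have to coincide with one of
  -- them, so `k ≤ 2`, which suffices because `m ≥ 2`.
  · by_contra! hk
    have hk0 : 2 < k := by omega
    push Not at hall
    set i₀ : Fin k := ⟨0, by omega⟩
    obtain ⟨i₁, hi₁⟩ := hall (ω i₀ ^ (m + 2)) (pow_ne_zero _ (hω0 i₀))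
    have h01 : i₀ ≠ i₁ := fun h => hi₁ (by rw [h])
    obtain ⟨l, hl⟩ : ∃ l, l ∉ ({i₀, i₁} : Finset (Fin k)) := by
      by_contra! hc
      have := Finset.card_le_card (fun l _ => hc l : Finset.univ ⊆ ({i₀, i₁} : Finset (Fin k)))
      rw [Finset.card_univ, Fintype.card_fin] at this
      have := this.trans Finset.card_le_two
      omega
    simp only [Finset.mem_insert, Finset.mem_singleton, not_or] at hl
    have e1 : ω i₁ = -ω i₀ := (hdich i₀ i₁ h01).resolve_left hi₁
    have e2 := hdich i₀ l (Ne.symm hl.1)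
    have e3 := hdich i₁ l (Ne.symm hl.2)
    rcases e2 with e2 | e2
    · rcases e3 with e3 | e3
      · exact hi₁ (e3.symm.trans e2)
      · refine hdist i₀ l (h _ _ (Ne.symm hl.1)) ?_
        rw [e3, e1, neg_neg]
    · exact hdist i₁ l (h _ _ (Ne.symm hl.2)) (by rw [e2, e1])

/-- The exponent lies between `2` and `m`, hence avoids `0` and `±1` modulo `m + 2`, where
`pathPoly` does not vanish. -/
lemma pathPoly_pathRoot_pow_even_eq_zero {m d : ℕ} (h0 : 0 < d) (hd : 2 * d + 2 ≤ m + 2) :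
    pathPoly m (pathRoot m ^ (2 * d)) = 0 := by
  have hprim := pathRoot_isPrimitive m
  refine pathPoly_eq_zero (hprim.pow_ne_one_of_pos_of_lt (by omega) (by omega)) ?_ ?_ (Or.inl ?_)
  · intro h
    have := hprim.pow_inj (i := 2 * d) (j := 1) (by omega) (by omega) (by rw [h, pow_one])
    omega
  · rw [← pow_succ]
    exact hprim.pow_ne_one_of_pos_of_lt (by omega) (by omega)
  · rw [← pow_mul, mul_comm, pow_mul, hprim.pow_eq_one, one_pow]

lemma pathPoly_conj (m : ℕ) (z : ℂ) : pathPoly m (conj z) = conj (pathPoly m z) := by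
  simp [pathPoly]

lemma gauWuNumber_id {m : ℕ} (hm : 2 ≤ m) (a b c : ℂ) (hbc : ‖b‖ ≠ ‖c‖) :
    gauWuNumber (zigzagToeplitz id (m + 1) a b c) = (m + 2) / 2 := by
  refine (isGreatest_gauWuNumber _).unique ⟨?_, fun k hk => ?_⟩
  · have hn : ∀ i, ‖pathRoot m ^ (2 * i)‖ = 1 := fun i => by
      rw [norm_pow, norm_pathRoot, one_pow]
    have key : ∀ i j, i < j → j < (m + 2) / 2 →
        pathPoly m (conj (pathRoot m ^ (2 * i)) * pathRoot m ^ (2 * j)) = 0 := by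
      intro i j hij hj
      have : 2 * j = 2 * i + 2 * (j - i) := by omega
      rw [this, pow_add, ← mul_assoc, conj_mul_self_of_norm_one (hn i), one_mul]
      exact pathPoly_pathRoot_pow_even_eq_zero (by omega) (by omega)
    refine mem_boundaryOrthonormalSizes (by omega) isZigzag_id a b c hbc
      (fun i => pathRoot m ^ (2 * (i : ℕ))) (fun i => hn i) ?_
    intro i j hij
    have hq0 : pathRoot m ≠ 0 := (pathRoot_isPrimitive m).ne_zero (by omega)
    rw [sum_id_eq_zero_iff (mul_ne_zero ((map_ne_zero _).mpr (pow_ne_zero _ hq0))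
      (pow_ne_zero _ hq0))]
    rcases lt_or_gt_of_ne hij with h | h
    · exact key i j h j.2
    -- Interchanging the two phases conjugates the ratio, and `pathPoly` has real coefficients.
    · have := key j i h i.2
      rw [← map_zero (starRingEnd ℂ), ← this, ← pathPoly_conj]
      congr 1
      rw [map_mul, Complex.conj_conj, mul_comm]
  · obtain ⟨ω, hω, h⟩ := exists_phases_of_mem (by omega) isZigzag_id a b c hbc hk
    have := card_le_of_pathPoly_eq_zero hm hω fun i j hij => by
      refine (sum_id_eq_zero_iff (mul_ne_zero ((map_ne_zero _).mpr ?_) ?_)).mp (h i j hij)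
      · intro h0; simpa [h0] using hω i
      · intro h0; simpa [h0] using hω j
    omega

end GauWu

end

theorem proposition5p1 (n : ℕ) (hn : 3 ≤ n) (a b c : ℂ) (hbc : ‖b‖ ≠ ‖c‖)
    (A A' : Matrix (Fin n) (Fin n) ℂ)
    (hA : A = GauWu.tridiagToeplitz n a b c) (hA' : A' = GauWu.swapOdd A) :
    GauWu.IsUnitarilyIrreducible A ∧
    GauWu.IsUnitarilyReducible A' ∧
    GauWu.basePolynomial A = GauWu.basePolynomial A' ∧
    GauWu.numericalRange A = GauWu.numericalRange A' ∧
    GauWu.gauWuNumber A = ⌈(n : ℝ) / 2⌉₊ ∧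
    GauWu.gauWuNumber A' = 2 ∧
    (5 ≤ n → GauWu.gauWuNumber A ≠ GauWu.gauWuNumber A') := by
  obtain ⟨m, rfl⟩ : ∃ m, n = m + 1 := ⟨n - 1, by omega⟩
  have hbase : GauWu.basePolynomial A = GauWu.basePolynomial A' := by
    rw [hA', hA]
    exact GauWu.basePolynomial_tridiagToeplitz _ a b c hbc
  rw [hA, GauWu.swapOdd_tridiagToeplitz_eq_zigzag] at hA'
  rw [GauWu.tridiagToeplitz_eq_zigzag] at hA
  -- Natural-number division: `⌊(n + 1) / 2⌋ = ⌈n / 2⌉`.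
  have hk : GauWu.gauWuNumber A = (m + 2) / 2 := by
    rw [hA]
    exact GauWu.gauWuNumber_id (by omega) a b c hbc
  have hk' : GauWu.gauWuNumber A' = 2 := by
    rw [hA']
    exact GauWu.gauWuNumber_alternation (by omega) a b c hbc
  refine ⟨?_, ?_, hbase, ?_, ?_, hk', ?_⟩
  · rw [hA]
    exact GauWu.isUnitarilyIrreducible_zigzag_id m a b c hbc
  · rw [hA']
    exact GauWu.isUnitarilyReducible_zigzag_alternation (by omega) a b c
  · rw [hA, hA', GauWu.numericalRange_zigzag (by omega) GauWu.isZigzag_id a b c hbc,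
      GauWu.numericalRange_zigzag (by omega) GauWu.isZigzag_alternation a b c hbc]
  · rw [hk, eq_comm, Nat.ceil_eq_iff (by omega)]
    have h1 : 2 * ((m + 2) / 2) ≤ m + 2 := by omega
    have h2 : m + 1 ≤ 2 * ((m + 2) / 2) := by omega
    have h1' : (2 : ℝ) * (((m + 2) / 2 : ℕ) : ℝ) ≤ m + 2 := by exact_mod_cast h1
    have h2' : (m : ℝ) + 1 ≤ 2 * (((m + 2) / 2 : ℕ) : ℝ) := by exact_mod_cast h2
    rw [Nat.cast_sub (by omega)]
    push_cast at h1' h2' ⊢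
    constructor <;> linarith
  · intro h5
    rw [hk, hk']
    omega
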